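/- Let $G$ be a discrete group, and regard $\ell^1(G)$ with convolution, $(f*g)(x)=\sum_{y\in G} f(y)\,g(y^{-1}x)$, as a dual Banach algebra with predual $c_0(G)$. Then the following are equivalent: (i) $G$ is amenable, i.e. there is a functional $m\in\ell^\infty(G)^*$ with $\|m\|=\langle 1,m\rangle=1$ that is invariant under left translations. (ii) $\ell^1(G)$ is Connes-amenable, i.e. for every normal, dual Banach $\ell^1(G)$-bimodule $E$, every bounded, weak*-continuous derivation $D\colon \ell^1(G)\to E$ is inner. (iii) There is a normal, virtual diagonal for $\ell^1(G)$. Here all spaces are over $\mathbb C$. A Banach bimodule $E$ over a Banach algebra $A$ is dual if $E=(E_*)^*$ for a closed submodule $E_*$ of $E^*$, where $\langle x,a\cdot\phi\rangle=\langle x\cdot a,\phi\rangle$ and $\langle x,\phi\cdot a\rangle=\langle a\cdot x,\phi\rangle$; its weak*-topology is $\sigma(E,E_*)$. A Banach algebra $A$ is dual if it is dual as a bimodule over itself. For a dual Banach algebra $A$, a dual Banach $A$-bimodule $E$ is normal if for each $x\in E$ the maps $a\mapsto a\cdot x$ and $a\mapsto x\cdot a$ from $A$ to $E$ are weak*-continuous.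 A derivation $D$ satisfies $D(ab)=a\cdot Db+Da\cdot b$, and is inner if $Da=a\cdot x-x\cdot a$ for some $x\in E$. For a dual Banach algebra $A$ with predual $A_*$, let $\mathcal L^2_{w^*}(A,\mathbb C)$ be the Banach space of bounded, separately weak*-continuous bilinear forms on $A$, with the actions $(\Phi\cdot a)(x,y)=\Phi(ax,y)$ and $(a\cdot\Phi)(x,y)=\Phi(x,ya)$. Let its dual carry the dual actions $\langle\Phi,a\cdot M\rangle=\langle\Phi\cdot a,M\rangle$ and $\langle\Phi,M\cdot a\rangle=\langle a\cdot\Phi,M\rangle$, and let $\Delta_{w^*}\colon\mathcal L^2_{w^*}(A,\mathbb C)^*\to A=(A_*)^*$ be the adjoint of the map $A_*\to\mathcal L^2_{w^*}(A,\mathbb C)$ that sends $\phi$ to $(x,y)\mapsto\langle xy,\phi\rangle$. A normal, virtual diagonal for $A$ is an element $M\in\mathcal L^2_{w^*}(A,\mathbb C)^*$ with $a\cdot M=M\cdot a$ and $a\,\Delta_{w^*}M=a$ for all $a\in A$. -/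

import Mathlib

set_option maxSynthPendingDepth 3

universe u

noncomputable section

open Filter Topology

/-! ### Banach bimodules and dual Banach bimodules -/

/-- The structure of a Banach `A`-`B`-bimodule on a Banach space `E`: two bounded bilinear actions,
`left a x` being `a · x` and `right b x` being `x · b`. -/
structure BanachBimodule (A B E : Type*)
    [NonUnitalNormedRing A] [NormedSpace ℂ A] [NonUnitalNormedRing B] [NormedSpace ℂ B]
    [NormedAddCommGroup E] [NormedSpace ℂ E] where
  left : A →L[ℂ] E →L[ℂ] E
  right : B →L[ℂ] E →L[ℂ] E
  left_mul : ∀ a a' x, left (a * a') x = left a (left a' x)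
  right_mul : ∀ b b' x, right (b * b') x = right b' (right b x)
  left_right : ∀ a b x, left a (right b x) = right b (left a x)

/-- A Banach algebra as a Banach bimodule over itself, by multiplication. -/
def BanachBimodule.self (A : Type*) [NonUnitalNormedRing A] [NormedSpace ℂ A]
    [IsScalarTower ℂ A A] [SMulCommClass ℂ A A] : BanachBimodule A A A where
  left := ContinuousLinearMap.mul ℂ A
  right := (ContinuousLinearMap.mul ℂ A).flip
  left_mul a a' x := by simp [mul_assoc]
  right_mul b b' x := by simp [mul_assoc]
  left_right a b x := by simp [mul_assoc]

section Dual

variable {E : Type*} [NormedAddCommGroup E] [NormedSpace ℂ E]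

/-- For a subspace `P` of `E^*`, the canonical map `E → P^*`, `x ↦ (φ ↦ φ x)`. -/
def toPredualDual (P : Submodule ℂ (StrongDual ℂ E)) : E →L[ℂ] StrongDual ℂ P :=
  ContinuousLinearMap.flip P.subtypeL

@[simp] theorem toPredualDual_apply (P : Submodule ℂ (StrongDual ℂ E)) (x : E) (φ : P) :
    toPredualDual P x φ = (φ : StrongDual ℂ E) x := rfl

/-- The weak-star topology `σ(E, P)` on `E` for a subspace `P` of `E^*`: the coarsest topology for
which every `φ ∈ P` is continuous. -/
abbrev wstar (P : Submodule ℂ (StrongDual ℂ E)) : TopologicalSpace E :=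
  ⨅ φ : P, TopologicalSpace.induced (fun x => (φ : StrongDual ℂ E) x) inferInstance

theorem continuous_wstar_iff {X : Type*} [TopologicalSpace X] (P : Submodule ℂ (StrongDual ℂ E))
    (f : X → E) : Continuous[_, wstar P] f ↔
      ∀ φ ∈ P, Continuous fun x => (φ : StrongDual ℂ E) (f x) := by
  simp only [continuous_iInf_rng, continuous_induced_rng, Subtype.forall]
  rfl

theorem continuous_wstar_apply (P : Submodule ℂ (StrongDual ℂ E)) {φ : StrongDual ℂ E}
    (hφ : φ ∈ P) : Continuous[wstar P, _] fun x => φ x :=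
  continuous_iInf_dom (i := (⟨φ, hφ⟩ : P)) continuous_induced_dom

variable {A B : Type*} [NonUnitalNormedRing A] [NormedSpace ℂ A]
  [NonUnitalNormedRing B] [NormedSpace ℂ B]

/-- The bimodule `E` is dual with predual `P`: `P` is a closed submodule of the
`B`-`A`-bimodule `E^*`, and `E = P^*` through the canonical map. -/
structure BanachBimodule.IsDual (m : BanachBimodule A B E)
    (P : Submodule ℂ (StrongDual ℂ E)) : Prop where
  isClosed : IsClosed (P : Set (StrongDual ℂ E))
  /-- `φ · a ∈ P`, where `⟨x, φ · a⟩ = ⟨a · x, φ⟩`. -/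
  comp_left_mem : ∀ φ ∈ P, ∀ a : A, φ.comp (m.left a) ∈ P
  /-- `b · φ ∈ P`, where `⟨x, b · φ⟩ = ⟨x · b, φ⟩`. -/
  comp_right_mem : ∀ φ ∈ P, ∀ b : B, φ.comp (m.right b) ∈ P
  norm_eq : ∀ x : E, ‖toPredualDual P x‖ = ‖x‖
  surjective : Function.Surjective (toPredualDual P)

end Dual

/-- A dual Banach algebra, with its fixed predual: a Banach algebra that is dual as a Banach
bimodule over itself. -/
class DualBanachAlgebra (A : Type*) [NonUnitalNormedRing A] [NormedSpace ℂ A]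
    [IsScalarTower ℂ A A] [SMulCommClass ℂ A A] where
  predual : Submodule ℂ (StrongDual ℂ A)
  isDual : (BanachBimodule.self A).IsDual predual

/-! ### Connes-amenability -/

section DualAlgebra

variable (A : Type*) [NonUnitalNormedRing A] [NormedSpace ℂ A]
  [IsScalarTower ℂ A A] [SMulCommClass ℂ A A] [DualBanachAlgebra A]

/-- The weak-star topology of a dual Banach algebra. -/
abbrev wstarAlg : TopologicalSpace A := wstar (DualBanachAlgebra.predual (A := A))

variable {A} in
/-- A Banach `A`-bimodule `E` with predual `P` is normal if `a ↦ a · x` and `a ↦ x · a` are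
weak-star continuous from `A` to `E` for every `x`. -/
def BanachBimodule.IsNormal {E : Type*} [NormedAddCommGroup E] [NormedSpace ℂ E]
    (m : BanachBimodule A A E) (P : Submodule ℂ (StrongDual ℂ E)) : Prop :=
  ∀ x : E, Continuous[wstarAlg A, wstar P] (fun a => m.left a x) ∧
    Continuous[wstarAlg A, wstar P] (fun a => m.right a x)

end DualAlgebra

/-- A bounded linear map `D : A → E` is a derivation if `D (ab) = a · D b + D a · b`. -/
def BanachBimodule.IsDerivation {A E : Type*} [NonUnitalNormedRing A] [NormedSpace ℂ A]
    [NormedAddCommGroup E] [NormedSpace ℂ E] (m : BanachBimodule A A E) (D : A →L[ℂ] E) : Prop :=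
  ∀ a b, D (a * b) = m.left a (D b) + m.right b (D a)

/-- `D` is inner if `D a = a · x - x · a` for some `x ∈ E`. -/
def BanachBimodule.IsInner {A E : Type*} [NonUnitalNormedRing A] [NormedSpace ℂ A]
    [NormedAddCommGroup E] [NormedSpace ℂ E] (m : BanachBimodule A A E) (D : A →L[ℂ] E) : Prop :=
  ∃ x : E, ∀ a, D a = m.left a x - m.right a x

/-- A dual Banach algebra `A` is Connes-amenable if every bounded, weak-star continuous derivation
from `A` into a normal, dual Banach `A`-bimodule is inner. -/
def ConnesAmenable (A : Type u) [NonUnitalNormedRing A] [NormedSpace ℂ A]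
    [IsScalarTower ℂ A A] [SMulCommClass ℂ A A] [DualBanachAlgebra A] : Prop :=
  ∀ (E : Type u) [NormedAddCommGroup E] [NormedSpace ℂ E] [CompleteSpace E]
    (m : BanachBimodule A A E) (P : Submodule ℂ (StrongDual ℂ E)),
    m.IsDual P → m.IsNormal P →
    ∀ D : A →L[ℂ] E, m.IsDerivation D → Continuous[wstarAlg A, wstar P] D → m.IsInner D

/-! ### Normal, virtual diagonals -/

section NormalVirtualDiagonal

variable (A : Type*) [NonUnitalNormedRing A] [NormedSpace ℂ A]
  [IsScalarTower ℂ A A] [SMulCommClass ℂ A A] [DualBanachAlgebra A]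

/-- The Banach space of bounded, separately weak-star continuous bilinear forms on `A`, a subspace
of the bounded bilinear forms, i.e. of the dual of the projective tensor product of `A` with
itself. -/
def SepWStar : Submodule ℂ (A →L[ℂ] A →L[ℂ] ℂ) where
  carrier := {Φ | (∀ x, Continuous[wstarAlg A, _] fun y => Φ x y) ∧
    ∀ y, Continuous[wstarAlg A, _] fun x => Φ x y}
  add_mem' {Φ Ψ} hΦ hΨ := by
    let _ := wstarAlg A
    exact ⟨fun x => (hΦ.1 x).add (hΨ.1 x), fun y => (hΦ.2 y).add (hΨ.2 y)⟩
  zero_mem' := by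
    let _ := wstarAlg A
    exact ⟨fun x => continuous_const, fun y => continuous_const⟩
  smul_mem' c Φ hΦ := by
    let _ := wstarAlg A
    exact ⟨fun x => (hΦ.1 x).const_smul c, fun y => (hΦ.2 y).const_smul c⟩

variable {A}

theorem continuous_wstarAlg_mul_left (a : A) :
    Continuous[wstarAlg A, wstarAlg A] fun x => a * x := by
  let _ := wstarAlg A
  rw [continuous_wstar_iff]
  intro φ hφ
  exact continuous_wstar_apply _ (DualBanachAlgebra.isDual.comp_left_mem φ hφ a)

theorem continuous_wstarAlg_mul_right (a : A) :
    Continuous[wstarAlg A, wstarAlg A] fun x => x * a := by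
  let _ := wstarAlg A
  rw [continuous_wstar_iff]
  intro φ hφ
  exact continuous_wstar_apply _ (DualBanachAlgebra.isDual.comp_right_mem φ hφ a)

/-- `Φ · a`, the bilinear form `(x, y) ↦ Φ (a x, y)`; this is the right action of `A` dual to
`a · (x ⊗ y) = ax ⊗ y`. -/
def SepWStar.actRight (Φ : SepWStar A) (a : A) : SepWStar A :=
  ⟨(Φ : A →L[ℂ] A →L[ℂ] ℂ).comp (ContinuousLinearMap.mul ℂ A a), by
    refine ⟨fun x => Φ.2.1 (a * x), fun y => ?_⟩
    let _ := wstarAlg A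
    exact (Φ.2.2 y).comp (continuous_wstarAlg_mul_left a)⟩

/-- `a · Φ`, the bilinear form `(x, y) ↦ Φ (x, y a)`; this is the left action of `A` dual to
`(x ⊗ y) · a = x ⊗ ya`. -/
def SepWStar.actLeft (a : A) (Φ : SepWStar A) : SepWStar A :=
  ⟨((Φ : A →L[ℂ] A →L[ℂ] ℂ).flip.comp ((ContinuousLinearMap.mul ℂ A).flip a)).flip, by
    refine ⟨fun x => ?_, fun y => Φ.2.2 (y * a)⟩
    let _ := wstarAlg A
    exact (Φ.2.1 x).comp (continuous_wstarAlg_mul_right a)⟩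

@[simp] theorem SepWStar.actRight_apply (Φ : SepWStar A) (a x y : A) :
    (SepWStar.actRight Φ a : A →L[ℂ] A →L[ℂ] ℂ) x y = (Φ : A →L[ℂ] A →L[ℂ] ℂ) (a * x) y := rfl

@[simp] theorem SepWStar.actLeft_apply (Φ : SepWStar A) (a x y : A) :
    (SepWStar.actLeft a Φ : A →L[ℂ] A →L[ℂ] ℂ) x y = (Φ : A →L[ℂ] A →L[ℂ] ℂ) x (y * a) := rfl

variable (A) in
/-- The restriction to the predual of the adjoint of the diagonal operator `x ⊗ y ↦ xy`: it sends
`φ` to the bilinear form `(x, y) ↦ φ (x y)`. -/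
def diagAdjoint : DualBanachAlgebra.predual (A := A) →L[ℂ] SepWStar A :=
  ContinuousLinearMap.codRestrict
    ((((ContinuousLinearMap.compL ℂ A (A →L[ℂ] A) (A →L[ℂ] ℂ)).flip
        (ContinuousLinearMap.mul ℂ A)).comp
      (ContinuousLinearMap.compL ℂ A A ℂ)).comp (Submodule.subtypeL _))
    (SepWStar A) (by
      intro φ
      let _ := wstarAlg A
      refine ⟨fun x => ?_, fun y => ?_⟩
      · exact (continuous_wstar_apply _ φ.2).comp (continuous_wstarAlg_mul_left x)
      · exact (continuous_wstar_apply _ φ.2).comp (continuous_wstarAlg_mul_right y))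

@[simp] theorem diagAdjoint_apply (φ : DualBanachAlgebra.predual (A := A)) (x y : A) :
    (diagAdjoint A φ : A →L[ℂ] A →L[ℂ] ℂ) x y = (φ : StrongDual ℂ A) (x * y) := rfl

variable (A) in
/-- The canonical identification of a dual Banach algebra with the dual of its predual. -/
def predualEquiv : A ≃ₗᵢ[ℂ] StrongDual ℂ (DualBanachAlgebra.predual (A := A)) :=
  LinearIsometryEquiv.ofSurjective
    ⟨(toPredualDual (DualBanachAlgebra.predual (A := A))).toLinearMap,
      DualBanachAlgebra.isDual.norm_eq⟩ DualBanachAlgebra.isDual.surjective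

/-- The extension of the diagonal operator to the dual of the separately weak-star continuous
bilinear forms, i.e. the adjoint of `diagAdjoint`. -/
def diagWStar (M : StrongDual ℂ (SepWStar A)) : A :=
  (predualEquiv A).symm (M.comp (diagAdjoint A))

/-- `M` is a normal, virtual diagonal: `a · M = M · a` and `a (Δ M) = a` for all `a`. Here
`⟨Φ, a · M⟩ = ⟨Φ · a, M⟩` and `⟨Φ, M · a⟩ = ⟨a · Φ, M⟩`. -/
def IsNormalVirtualDiagonal (M : StrongDual ℂ (SepWStar A)) : Prop :=
  (∀ (a : A) (Φ : SepWStar A), M (SepWStar.actRight Φ a) = M (SepWStar.actLeft a Φ)) ∧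
    ∀ a : A, a * diagWStar M = a

end NormalVirtualDiagonal

/-! ### Amenable discrete groups -/

/-- The left translate `x ↦ f (g⁻¹ x)` of a bounded function `f` on a group. -/
def leftTranslate {G : Type*} [Group G] (g : G) (f : lp (fun _ : G => ℂ) ⊤) :
    lp (fun _ : G => ℂ) ⊤ :=
  ⟨fun x => f (g⁻¹ * x), by
    refine memℓp_infty ⟨‖f‖, ?_⟩
    rintro _ ⟨x, rfl⟩
    exact lp.norm_apply_le_norm (by simp) f _⟩

/-- A discrete group `G` is amenable if there is a left invariant mean on the bounded functions
on `G`. -/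
def DiscreteAmenable (G : Type*) [Group G] : Prop :=
  ∃ m : StrongDual ℂ (lp (fun _ : G => ℂ) ⊤),
    ‖m‖ = 1 ∧ m 1 = 1 ∧ ∀ g f, m (leftTranslate g f) = m f

/-! ### The space `ℓ¹(G)` -/

/-- The Banach space of summable complex functions on `G`. -/
abbrev L1 (G : Type*) := lp (fun _ : G => ℂ) 1

namespace L1

variable {G : Type*}

theorem norm_eq (a : L1 G) : ‖a‖ = ∑' g, ‖a g‖ := by
  simpa using lp.norm_eq_tsum_rpow (p := 1) (by simp) a

theorem summable_norm (a : L1 G) : Summable fun g => ‖a g‖ := by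
  simpa using (lp.memℓp a).summable (by simp)

theorem mem_of_summable {f : G → ℂ} (hf : Summable fun g => ‖f g‖) :
    Memℓp (E := fun _ : G => ℂ) f 1 :=
  memℓp_gen (by simpa using hf)

theorem norm_apply_le (a : L1 G) (g : G) : ‖a g‖ ≤ ‖a‖ :=
  lp.norm_apply_le_norm (by simp) a g

/-! ### The predual `c₀(G)` of `ℓ¹(G)` -/

open Classical in
/-- The point mass at `g`. -/
def delta (g : G) : L1 G := lp.single 1 g 1

theorem delta_apply_self (g : G) : delta g g = 1 := by simp [delta]

theorem delta_apply_ne {g x : G} (h : x ≠ g) : delta g x = 0 := by simp [delta, h]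

theorem norm_delta (g : G) : ‖delta g‖ = 1 := by
  classical
  rw [norm_eq, tsum_eq_single g fun x hx => by simp [delta_apply_ne hx]]
  simp [delta_apply_self]

theorem hasSum_apply (φ : StrongDual ℂ (L1 G)) (a : L1 G) :
    HasSum (fun g => φ (delta g) * a g) (φ a) := by
  classical
  have h := φ.hasSum (lp.hasSum_single (p := 1) (by simp) a)
  refine h.congr_fun fun g => ?_
  have : lp.single (E := fun _ : G => ℂ) 1 g (a g) = a g • delta g := by
    rw [delta, ← lp.single_smul]; simp
  change _ = φ (lp.single 1 g (a g))
  rw [this, map_smul, smul_eq_mul, mul_comm]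

theorem norm_apply_delta_le (φ : StrongDual ℂ (L1 G)) (g : G) : ‖φ (delta g)‖ ≤ ‖φ‖ := by
  simpa [norm_delta] using φ.le_opNorm (delta g)

theorem norm_le_of_delta {φ : StrongDual ℂ (L1 G)} {C : ℝ} (hC : 0 ≤ C)
    (h : ∀ g, ‖φ (delta g)‖ ≤ C) : ‖φ‖ ≤ C := by
  refine φ.opNorm_le_bound hC fun a => ?_
  have hb : ∀ g, ‖φ (delta g) * a g‖ ≤ C * ‖a g‖ := fun g => by
    rw [norm_mul]; exact mul_le_mul_of_nonneg_right (h g) (norm_nonneg _)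
  rw [← (hasSum_apply φ a).tsum_eq, norm_eq, ← tsum_mul_left]
  exact tsum_of_norm_bounded ((summable_norm a).mul_left C).hasSum hb

theorem exists_c0_iff (φ : StrongDual ℂ (L1 G)) :
    (∃ f : G → ℂ, Tendsto f cofinite (𝓝 0) ∧ ∀ a : L1 G, φ a = ∑' g, f g * a g) ↔
      Tendsto (fun g => φ (delta g)) cofinite (𝓝 0) := by
  constructor
  · rintro ⟨f, hf, h⟩
    refine hf.congr fun g => ?_
    rw [h, tsum_eq_single g fun x hx => by simp [delta_apply_ne hx]]
    simp [delta_apply_self]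
  · exact fun h => ⟨_, h, fun a => (hasSum_apply φ a).tsum_eq.symm⟩

variable (G) in
/-- The copy of `c₀(G)` in the dual of `ℓ¹(G)`: the functionals `a ↦ ∑ g, f g * a g`, where
`f : G → ℂ` vanishes at infinity. -/
def c0 : Submodule ℂ (StrongDual ℂ (L1 G)) where
  carrier := {φ | ∃ f : G → ℂ, Tendsto f cofinite (𝓝 0) ∧ ∀ a : L1 G, φ a = ∑' g, f g * a g}
  add_mem' {φ ψ} hφ hψ := by
    rw [Set.mem_ofPred_eq, exists_c0_iff] at hφ hψ ⊢
    simpa using hφ.add hψ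
  zero_mem' := ⟨0, tendsto_const_nhds, by simp⟩
  smul_mem' c φ hφ := by
    rw [Set.mem_ofPred_eq, exists_c0_iff] at hφ ⊢
    simpa using hφ.const_mul c

theorem mem_c0_iff {φ : StrongDual ℂ (L1 G)} :
    φ ∈ c0 G ↔ Tendsto (fun g => φ (delta g)) cofinite (𝓝 0) :=
  exists_c0_iff φ

theorem isClosed_c0 : IsClosed (c0 G : Set (StrongDual ℂ (L1 G))) := by
  refine isClosed_of_closure_subset fun φ hφ => ?_
  rw [SetLike.mem_coe, mem_c0_iff, Metric.tendsto_nhds]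
  intro ε hε
  obtain ⟨ψ, hψ, hd⟩ := Metric.mem_closure_iff.1 hφ (ε / 2) (half_pos hε)
  filter_upwards [Metric.tendsto_nhds.1 (mem_c0_iff.1 hψ) (ε / 2) (half_pos hε)] with g hg
  rw [dist_zero_right] at hg ⊢
  rw [dist_eq_norm] at hd
  have h1 := norm_apply_delta_le (φ - ψ) g
  have h2 := norm_add_le ((φ - ψ) (delta g)) (ψ (delta g))
  have h3 : (φ - ψ) (delta g) + ψ (delta g) = φ (delta g) := by simp
  rw [h3] at h2
  linarith

theorem tendsto_tsum_c0 {f : G → ℂ} {C : ℝ} (hC : ∀ g, ‖f g‖ ≤ C)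
    (hf : Tendsto f cofinite (𝓝 0)) (a : L1 G) (e : G → G → G)
    (he : ∀ h, Function.Injective (e h)) :
    Tendsto (fun g => ∑' h, f (e h g) * a h) cofinite (𝓝 0) := by
  have h0 : (0 : ℂ) = ∑' h : G, (0 : ℂ) * a h := by simp
  rw [h0]
  refine tendsto_tsum_of_dominated_convergence ((summable_norm a).mul_left C) (fun h => ?_)
    (Eventually.of_forall fun g h => ?_)
  · exact (hf.comp (he h).tendsto_cofinite).mul_const _
  · rw [norm_mul]
    exact mul_le_mul_of_nonneg_right (hC _) (norm_nonneg _)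

/-- Evaluation at a point, as a functional on `ℓ¹(G)`. -/
def evalAt (g : G) : StrongDual ℂ (L1 G) := lp.evalCLM ℂ (fun _ : G => ℂ) 1 g

@[simp] theorem evalAt_apply (g : G) (a : L1 G) : evalAt g a = a g := rfl

theorem evalAt_mem (g : G) : evalAt g ∈ c0 G := by
  rw [mem_c0_iff]
  refine tendsto_const_nhds.congr' ?_
  filter_upwards [(Set.finite_singleton g).compl_mem_cofinite] with h hh
  rw [evalAt_apply, delta_apply_ne]
  rintro rfl
  exact hh rfl

/-- The functional `a ↦ ∑ g ∈ s, c g * a g`. -/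
def finFunctional (s : Finset G) (c : G → ℂ) : StrongDual ℂ (L1 G) := ∑ g ∈ s, c g • evalAt g

theorem finFunctional_apply (s : Finset G) (c : G → ℂ) (a : L1 G) :
    finFunctional s c a = ∑ g ∈ s, c g * a g := by
  simp [finFunctional]

theorem finFunctional_delta_of_mem {s : Finset G} (c : G → ℂ) {g : G} (hg : g ∈ s) :
    finFunctional s c (delta g) = c g := by
  rw [finFunctional_apply, Finset.sum_eq_single g (fun x _ hx => by simp [delta_apply_ne hx])
    (fun h => absurd hg h), delta_apply_self, mul_one]

theorem finFunctional_delta_of_notMem {s : Finset G} (c : G → ℂ) {g : G} (hg : g ∉ s) :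
    finFunctional s c (delta g) = 0 := by
  rw [finFunctional_apply]
  refine Finset.sum_eq_zero fun x hx => ?_
  rw [delta_apply_ne, mul_zero]
  rintro rfl
  exact hg hx

theorem finFunctional_mem (s : Finset G) (c : G → ℂ) : finFunctional s c ∈ c0 G :=
  Submodule.sum_mem _ fun g _ => Submodule.smul_mem _ _ (evalAt_mem g)

theorem norm_finFunctional_le (s : Finset G) {c : G → ℂ} (hc : ∀ g, ‖c g‖ ≤ 1) :
    ‖finFunctional s c‖ ≤ 1 := by
  refine norm_le_of_delta zero_le_one fun g => ?_
  by_cases hg : g ∈ s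
  · rw [finFunctional_delta_of_mem c hg]; exact hc g
  · rw [finFunctional_delta_of_notMem c hg]; simp

/-- The conjugate phase of a complex number. -/
def phase (z : ℂ) : ℂ := star z / ‖z‖

theorem norm_phase_le (z : ℂ) : ‖phase z‖ ≤ 1 := by
  rw [phase, norm_div, norm_star, Complex.norm_real, norm_norm]
  exact div_self_le_one _

theorem phase_mul (z : ℂ) : phase z * z = ‖z‖ := by
  rcases eq_or_ne z 0 with rfl | hz
  · simp
  · have h : (‖z‖ : ℂ) ≠ 0 := by simpa using hz
    rw [phase, div_mul_eq_mul_div, div_eq_iff h]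
    simpa [sq] using Complex.conj_mul' z

/-- A bounded functional on `c₀(G)` has summable values on the coordinate functionals. -/
theorem sum_norm_le (F : StrongDual ℂ (c0 G)) (s : Finset G) :
    ∑ g ∈ s, ‖F ⟨evalAt g, evalAt_mem g⟩‖ ≤ ‖F‖ := by
  set z : G → ℂ := fun g => F ⟨evalAt g, evalAt_mem g⟩
  set ψ : c0 G := ⟨finFunctional s fun g => phase (z g), finFunctional_mem _ _⟩
  have h1 : F ψ = ((∑ g ∈ s, ‖z g‖ : ℝ) : ℂ) := by
    have : ψ = ∑ g ∈ s, phase (z g) • (⟨evalAt g, evalAt_mem g⟩ : c0 G) := by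
      ext1; simp [ψ, finFunctional]
    rw [this, map_sum]
    push_cast
    exact Finset.sum_congr rfl fun g _ => by rw [map_smul, smul_eq_mul]; exact phase_mul _
  have h2 : ‖F ψ‖ ≤ ‖F‖ * ‖ψ‖ := F.le_opNorm ψ
  have h3 : ‖ψ‖ ≤ 1 := norm_finFunctional_le s fun g => norm_phase_le _
  rw [h1, Complex.norm_real, Real.norm_of_nonneg (Finset.sum_nonneg fun _ _ => norm_nonneg _)] at h2
  nlinarith [norm_nonneg F]

/-! ### Convolution -/

variable [Group G]

/-- Change of variables `(y, z) ↦ (y, y z)` on `G × G`. -/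
def shear : G × G ≃ G × G where
  toFun p := (p.1, p.1⁻¹ * p.2)
  invFun p := (p.1, p.1 * p.2)
  left_inv p := by simp
  right_inv p := by simp

theorem summable_conv_prod (a b : L1 G) :
    Summable fun p : G × G => ‖a p.1‖ * ‖b (p.1⁻¹ * p.2)‖ :=
  (shear (G := G)).summable_iff.2 ((summable_norm a).mul_of_nonneg (summable_norm b)
    (fun _ => norm_nonneg _) (fun _ => norm_nonneg _))

theorem summable_conv_norm (a b : L1 G) (x : G) :
    Summable fun y => ‖a y * b (y⁻¹ * x)‖ := by
  simp only [norm_mul]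
  exact ((summable_conv_prod a b).prod_symm).prod_factor x

theorem summable_conv (a b : L1 G) (x : G) :
    Summable fun y => a y * b (y⁻¹ * x) :=
  (summable_conv_norm a b x).of_norm

theorem norm_conv_le (a b : L1 G) (x : G) :
    ‖∑' y, a y * b (y⁻¹ * x)‖ ≤ ∑' y, ‖a y‖ * ‖b (y⁻¹ * x)‖ := by
  simpa only [norm_mul] using norm_tsum_le_tsum_norm (summable_conv_norm a b x)

theorem summable_conv_sum (a b : L1 G) :
    Summable fun x => ∑' y, ‖a y‖ * ‖b (y⁻¹ * x)‖ :=
  (summable_conv_prod a b).prod_symm.prod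

/-- The convolution product `(a * b) x = ∑ y, a y b (y⁻¹ x)`. -/
instance : Mul (L1 G) where
  mul a b := ⟨fun x => ∑' y, a y * b (y⁻¹ * x), mem_of_summable
    ((summable_conv_sum a b).of_nonneg_of_le (fun _ => norm_nonneg _) (norm_conv_le a b))⟩

theorem mul_apply (a b : L1 G) (x : G) : (a * b) x = ∑' y, a y * b (y⁻¹ * x) := rfl

theorem mul_assoc' (a b c : L1 G) : a * b * c = a * (b * c) := by
  ext x
  have key : Summable fun p : G × G => a p.1 * b (p.1⁻¹ * p.2) * c (p.2⁻¹ * x) := by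
    refine Summable.of_norm_bounded ((summable_conv_prod a b).mul_right ‖c‖) fun p => ?_
    rw [norm_mul, norm_mul]
    exact mul_le_mul_of_nonneg_left (norm_apply_le c _) (by positivity)
  calc (a * b * c) x = ∑' y, ∑' z, a z * b (z⁻¹ * y) * c (y⁻¹ * x) := by
        simp only [mul_apply, tsum_mul_right]
    _ = ∑' z, ∑' y, a z * b (z⁻¹ * y) * c (y⁻¹ * x) :=
        Summable.tsum_comm (f := fun z y => a z * b (z⁻¹ * y) * c (y⁻¹ * x)) key
    _ = ∑' z, a z * ∑' y, b y * c (y⁻¹ * (z⁻¹ * x)) := by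
        refine tsum_congr fun z => ?_
        rw [← tsum_mul_left, ← (Equiv.mulLeft z).tsum_eq]
        exact tsum_congr fun y => by simp [mul_assoc]
    _ = (a * (b * c)) x := rfl

theorem norm_mul_le' (a b : L1 G) : ‖a * b‖ ≤ ‖a‖ * ‖b‖ := by
  calc ‖a * b‖ = ∑' x, ‖(a * b) x‖ := norm_eq _
    _ ≤ ∑' x, ∑' y, ‖a y‖ * ‖b (y⁻¹ * x)‖ :=
        (summable_norm (a * b)).tsum_le_tsum (norm_conv_le a b) (summable_conv_sum a b)
    _ = ∑' y, ∑' x, ‖a y‖ * ‖b (y⁻¹ * x)‖ :=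
        Summable.tsum_comm (f := fun y x => ‖a y‖ * ‖b (y⁻¹ * x)‖) (summable_conv_prod a b)
    _ = ∑' y, ‖a y‖ * ‖b‖ := by
        refine tsum_congr fun y => ?_
        rw [tsum_mul_left, norm_eq b, ← (Equiv.mulLeft y).tsum_eq]
        simp
    _ = ‖a‖ * ‖b‖ := by rw [tsum_mul_right, norm_eq a]

instance : NonUnitalNormedRing (L1 G) where
  left_distrib a b c := by
    ext x
    simp only [mul_apply, lp.coeFn_add, Pi.add_apply, mul_add]
    exact (summable_conv a b x).tsum_add (summable_conv a c x)
  right_distrib a b c := by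
    ext x
    simp only [mul_apply, lp.coeFn_add, Pi.add_apply, add_mul]
    exact (summable_conv a c x).tsum_add (summable_conv b c x)
  zero_mul a := by ext x; simp [mul_apply]
  mul_zero a := by ext x; simp [mul_apply]
  mul_assoc := mul_assoc'
  norm_mul_le := norm_mul_le'
  dist_eq := (inferInstance : NormedAddCommGroup (L1 G)).dist_eq

instance : IsScalarTower ℂ (L1 G) (L1 G) where
  smul_assoc c a b := by
    ext x
    simp [mul_apply, ← tsum_mul_left, mul_assoc]

instance : SMulCommClass ℂ (L1 G) (L1 G) where
  smul_comm c a b := by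
    ext x
    simp [mul_apply, ← tsum_mul_left, mul_left_comm]

theorem mul_delta_apply (a : L1 G) (g x : G) : (a * delta g) x = a (x * g⁻¹) := by
  rw [mul_apply, tsum_eq_single (x * g⁻¹) fun y hy => ?_]
  · simp [delta_apply_self]
  · rw [delta_apply_ne, mul_zero]
    rintro rfl
    simp at hy

theorem delta_mul_apply (a : L1 G) (g x : G) : (delta g * a) x = a (g⁻¹ * x) := by
  rw [mul_apply, tsum_eq_single g fun y hy => by simp [delta_apply_ne hy]]
  simp [delta_apply_self]

/-- `ℓ¹(G) = c₀(G)^*` is a dual Banach algebra. -/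
theorem isDual_c0 : (BanachBimodule.self (L1 G)).IsDual (c0 G) where
  isClosed := isClosed_c0
  comp_left_mem φ hφ a := by
    rw [mem_c0_iff] at hφ ⊢
    refine (tendsto_tsum_c0 (norm_apply_delta_le φ) hφ a (fun h g => h * g)
      fun h => mul_right_injective h).congr fun g => ?_
    change _ = φ (a * delta g)
    rw [← (hasSum_apply φ _).tsum_eq, ← (Equiv.mulRight g).tsum_eq fun x => φ (delta x) * (a * delta g) x]
    simp [mul_delta_apply]
  comp_right_mem φ hφ a := by
    rw [mem_c0_iff] at hφ ⊢
    refine (tendsto_tsum_c0 (norm_apply_delta_le φ) hφ a (fun h g => g * h)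
      fun h => mul_left_injective h).congr fun g => ?_
    change _ = φ (delta g * a)
    rw [← (hasSum_apply φ _).tsum_eq, ← (Equiv.mulLeft g).tsum_eq fun x => φ (delta x) * (delta g * a) x]
    simp [delta_mul_apply]
  norm_eq a := by
    refine le_antisymm ?_ ?_
    · refine ContinuousLinearMap.opNorm_le_bound _ (norm_nonneg _) fun φ => ?_
      rw [mul_comm]
      exact (φ : StrongDual ℂ (L1 G)).le_opNorm a
    · rw [norm_eq]
      refine (summable_norm a).tsum_le_of_sum_le fun s => ?_
      exact sum_norm_le (toPredualDual (c0 G) a) s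
  surjective F := by
    have hs : Summable fun g => ‖F ⟨evalAt g, evalAt_mem g⟩‖ :=
      summable_of_sum_le (fun _ => norm_nonneg _) (sum_norm_le F)
    set a : L1 G := ⟨fun g => F ⟨evalAt g, evalAt_mem g⟩, mem_of_summable hs⟩
    refine ⟨a, ?_⟩
    ext φ
    obtain ⟨φ, hφ⟩ := φ
    rw [toPredualDual_apply]
    let T : Finset G → c0 G := fun s =>
      ⟨finFunctional s fun g => φ (delta g), finFunctional_mem _ _⟩
    have hT : Tendsto T atTop (𝓝 ⟨φ, hφ⟩) := by
      rw [Metric.tendsto_nhds]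
      intro ε hε
      have hfin : {g | ¬ dist (φ (delta g)) 0 < ε / 2}.Finite :=
        Metric.tendsto_nhds.1 (mem_c0_iff.1 hφ) (ε / 2) (half_pos hε)
      filter_upwards [eventually_ge_atTop hfin.toFinset] with s hsub
      refine lt_of_le_of_lt ?_ (half_lt_self hε)
      rw [dist_eq_norm]
      refine norm_le_of_delta (half_pos hε).le fun g => ?_
      change ‖finFunctional s (fun g => φ (delta g)) (delta g) - φ (delta g)‖ ≤ ε / 2
      by_cases hg : g ∈ s
      · rw [finFunctional_delta_of_mem _ hg]; simpa using (half_pos hε).le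
      · rw [finFunctional_delta_of_notMem _ hg, zero_sub, norm_neg]
        by_contra hlt
        refine hg (hsub ?_)
        rw [Set.Finite.mem_toFinset, Set.mem_ofPred_eq, dist_zero_right]
        exact fun h => hlt h.le
    refine tendsto_nhds_unique (hasSum_apply φ a) (((F.continuous.tendsto _).comp hT).congr
      fun s => ?_)
    have : T s = ∑ g ∈ s, φ (delta g) • (⟨evalAt g, evalAt_mem g⟩ : c0 G) := by
      ext1; simp [T, finFunctional]
    rw [Function.comp_apply, this, map_sum]
    exact Finset.sum_congr rfl fun g _ => by rw [map_smul, smul_eq_mul]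

/-- `ℓ¹(G)` as a dual Banach algebra, with its standard predual `c₀(G)`. -/
instance : DualBanachAlgebra (L1 G) where
  predual := c0 G
  isDual := isDual_c0

end L1

end

/-! A bounded operator on `L1 G` is determined by its values on the point masses (`clm_ext`), and it
is weak-star continuous exactly when its coefficients at `delta g` vanish at infinity
(`continuous_wstarAlg_wstar_iff`). Identities and continuity thus become statements about group
elements.

From an invariant mean `m`, average over the antidiagonal: `M Φ` is the mean of `g ↦ Φ (delta g)
(delta g⁻¹)`. Invariance of `m` gives `a · M = M · a`, and `delta g * delta g⁻¹ = delta 1` makes the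
diagonal of `M` the unit. From a normal virtual diagonal `M`, a derivation `D` is inner through the
point `x` with `φ x = M ((a, b) ↦ φ (a · D b))`, up to a correction because `delta 1` need not act
as the identity. Normality of the module and weak-star continuity of `D` make these forms admissible
for `M`.

The remaining implication needs a suitable normal module. The usual one, the dual of the bounded
functions modulo constants with trivial action on one side, fails when `G` is infinite: the trivial
action is not weak-star continuous. Instead, `G`-indexed copies of `Y` are assembled into `ℓ²(G,
Y)`, and both actions move the index. Coefficients of a functional on `ℓ²(G, Y)` vanish at infinity,
so the dual is normal even though `G` acts on `Y` only by bounded operators. A bounded cocycle `κ`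
becomes the derivation reading the coordinate `g` at `delta g`. Restricting an implementing
functional to the copy of `Y` at the identity shows that `κ` is a coboundary
(`exists_eq_sub_of_connesAmenable`). For `κ g = ev 1 - ev g⁻¹` this yields a bounded invariant
functional equal to `1` at `1`, and the positive part of its real part, normalized, gives a mean
(`discreteAmenable_of_invariant`). -/

noncomputable section

open Filter Topology

/-! ### Bounded operators on `ℓ¹(G)` through the point masses -/

namespace L1

section Lift

variable {G V : Type*} [NormedAddCommGroup V] [NormedSpace ℂ V]

/-- Bounded linear maps on `ℓ¹(G)` that agree on the point masses are equal. -/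
theorem clm_ext {S T : L1 G →L[ℂ] V} (h : ∀ g, S (delta g) = T (delta g)) : S = T := by
  classical
  refine lp.ext_continuousLinearMap (by simp) fun g => ?_
  ext
  have := h g
  simp only [delta] at this
  change S (lp.single 1 g 1) = T (lp.single 1 g 1)
  convert this

variable [CompleteSpace V]

/-- The bounded linear map `a ↦ ∑ g, a g • u g` on `ℓ¹(G)` of a bounded family `u`. -/
def lift (u : G → V) {C : ℝ} (hC : 0 ≤ C) (hu : ∀ g, ‖u g‖ ≤ C) : L1 G →L[ℂ] V :=
  (lp.tsumCLM ℂ G V).comp (lp.mapCLM 1 (fun g => ContinuousLinearMap.toSpanSingleton ℂ (u g)) hC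
    (by simpa using hu))

@[simp] theorem lift_delta (u : G → V) {C : ℝ} (hC : 0 ≤ C) (hu : ∀ g, ‖u g‖ ≤ C) (g : G) :
    lift u hC hu (delta g) = u g := by
  simp only [lift, ContinuousLinearMap.comp_apply, lp.tsumCLM_apply, lp.mapCLM_apply_coe,
    ContinuousLinearMap.toSpanSingleton_apply]
  rw [tsum_eq_single g fun x hx => by simp [delta_apply_ne hx], delta_apply_self, one_smul]

end Lift

variable {G : Type*}

/-- The point masses tend to `0` weak-star at infinity; hence weak-star continuous functionals
lie in `c₀(G)`. -/
theorem mem_c0_of_continuous {φ : StrongDual ℂ (L1 G)}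
    (h : Continuous[wstar (c0 G), _] fun a => φ a) : φ ∈ c0 G := by
  rw [mem_c0_iff]
  have hd : Tendsto (delta : G → L1 G) cofinite (@nhds _ (wstar (c0 G)) 0) := by
    rw [nhds_iInf, tendsto_iInf]
    intro ψ
    rw [nhds_induced, tendsto_comap_iff]
    simpa [Function.comp_def] using mem_c0_iff.1 ψ.2
  have := (@Continuous.tendsto _ _ (wstar (c0 G)) _ _ h 0).comp hd
  simpa [Function.comp_def] using this

variable [Group G]

theorem continuous_wstarAlg_iff {φ : StrongDual ℂ (L1 G)} :
    Continuous[wstarAlg (L1 G), _] (fun a => φ a) ↔ φ ∈ c0 G :=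
  ⟨mem_c0_of_continuous, continuous_wstar_apply _⟩

/-- Weak-star continuity of a bounded operator on `ℓ¹(G)` in terms of the point masses. -/
theorem continuous_wstarAlg_wstar_iff {E : Type*} [NormedAddCommGroup E] [NormedSpace ℂ E]
    {P : Submodule ℂ (StrongDual ℂ E)} {T : L1 G →L[ℂ] E} :
    Continuous[wstarAlg (L1 G), wstar P] T ↔
      ∀ φ ∈ P, Tendsto (fun g => φ (T (delta g))) cofinite (𝓝 0) := by
  refine (@continuous_wstar_iff _ _ _ _ (wstarAlg (L1 G)) P T).trans ?_
  refine forall₂_congr fun φ _ => ?_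
  exact (continuous_wstarAlg_iff (φ := φ.comp T)).trans mem_c0_iff

theorem delta_mul_delta (g h : G) : delta g * delta h = delta (g * h) := by
  ext x
  rw [delta_mul_apply]
  by_cases hx : x = g * h
  · subst hx; simp [delta_apply_self]
  · rw [delta_apply_ne hx, delta_apply_ne]
    rintro rfl
    simp at hx

theorem delta_one_mul (a : L1 G) : delta 1 * a = a := by
  ext x; simp [delta_mul_apply]

theorem mul_delta_one (a : L1 G) : a * delta 1 = a := by
  ext x; simp [mul_delta_apply]

/-- The bounded function `g ↦ Φ (δ_g, δ_{g⁻¹})` of a bounded bilinear form `Φ` on `ℓ¹(G)`. -/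
def antidiagonal : (L1 G →L[ℂ] L1 G →L[ℂ] ℂ) →L[ℂ] lp (fun _ : G => ℂ) ⊤ :=
  have key (Φ : L1 G →L[ℂ] L1 G →L[ℂ] ℂ) (g : G) : ‖Φ (delta g) (delta g⁻¹)‖ ≤ ‖Φ‖ := by
    simpa [norm_delta] using Φ.le_opNorm₂ (delta g) (delta g⁻¹)
  LinearMap.mkContinuous
    { toFun := fun Φ => ⟨fun g => Φ (delta g) (delta g⁻¹),
        memℓp_infty ⟨‖Φ‖, by rintro _ ⟨g, rfl⟩; exact key Φ g⟩⟩
      map_add' := fun _ _ => by ext; simp; rfl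
      map_smul' := fun _ _ => by ext; simp } 1
    fun Φ => by
      rw [one_mul]
      exact lp.norm_le_of_forall_le (norm_nonneg _) (key Φ)

@[simp] theorem antidiagonal_apply (Φ : L1 G →L[ℂ] L1 G →L[ℂ] ℂ) (g : G) :
    antidiagonal Φ g = Φ (delta g) (delta g⁻¹) := rfl

end L1

/-! ### From an invariant mean to a normal virtual diagonal -/

open L1

variable {G : Type*} [Group G]

theorem exists_isNormalVirtualDiagonal_of_discreteAmenable (h : DiscreteAmenable G) :
    ∃ M : StrongDual ℂ (SepWStar (L1 G)), IsNormalVirtualDiagonal M := by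
  obtain ⟨m, -, hm1, hm⟩ := h
  let M₀ : (L1 G →L[ℂ] L1 G →L[ℂ] ℂ) →L[ℂ] ℂ := m.comp antidiagonal
  refine ⟨M₀.comp (Submodule.subtypeL _), fun a Φ => ?_, fun a => ?_⟩
  · let Ψ : L1 G →L[ℂ] L1 G →L[ℂ] ℂ := Φ
    -- For fixed `Φ`, both sides of `a · M = M · a` are bounded and linear in `a`, so point masses
    -- suffice.
    let R : L1 G →L[ℂ] (L1 G →L[ℂ] L1 G →L[ℂ] ℂ) :=
      (ContinuousLinearMap.compL ℂ (L1 G) (L1 G) (L1 G →L[ℂ] ℂ) Ψ).comp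
        (ContinuousLinearMap.mul ℂ (L1 G))
    let L : L1 G →L[ℂ] (L1 G →L[ℂ] L1 G →L[ℂ] ℂ) :=
      ((ContinuousLinearMap.flipₗᵢ ℂ (L1 G) (L1 G) ℂ : _ →L[ℂ] _).comp
        (ContinuousLinearMap.compL ℂ (L1 G) (L1 G) (L1 G →L[ℂ] ℂ) Ψ.flip)).comp
        (ContinuousLinearMap.mul ℂ (L1 G)).flip
    have hRL : M₀.comp R = M₀.comp L := by
      refine clm_ext fun g => ?_
      change m (antidiagonal (R (delta g))) = m (antidiagonal (L (delta g)))
      -- Translating by `g⁻¹` substitutes `g x` for `x`; then both functions equal `x ↦ Φ (δ_{gx},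
      -- δ_{x⁻¹})`.
      rw [← hm g⁻¹ (antidiagonal (L (delta g)))]
      congr 1
      ext x
      change Ψ (delta g * delta x) (delta x⁻¹) =
        Ψ (delta (g⁻¹⁻¹ * x)) (delta (g⁻¹⁻¹ * x)⁻¹ * delta g)
      simp [delta_mul_delta]
    exact congrArg (fun T : L1 G →L[ℂ] ℂ => T a) hRL
  · have : diagWStar (M₀.comp (Submodule.subtypeL (SepWStar (L1 G)))) = delta 1 := by
      rw [diagWStar, LinearIsometryEquiv.symm_apply_eq]
      ext φ
      change m (antidiagonal (diagAdjoint (L1 G) φ : L1 G →L[ℂ] L1 G →L[ℂ] ℂ)) =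
        (φ : StrongDual ℂ (L1 G)) (delta 1)
      have h1 : antidiagonal (diagAdjoint (L1 G) φ : L1 G →L[ℂ] L1 G →L[ℂ] ℂ) =
          (φ : StrongDual ℂ (L1 G)) (delta 1) • (1 : lp (fun _ : G => ℂ) ⊤) := by
        ext x
        simp [delta_mul_delta]
      rw [h1, map_smul, hm1, smul_eq_mul, mul_one]
    rw [this, mul_delta_one]

/-! ### From a normal virtual diagonal to Connes-amenability -/

section Dual

variable {A B E : Type*} [NonUnitalNormedRing A] [NormedSpace ℂ A]
  [NonUnitalNormedRing B] [NormedSpace ℂ B] [NormedAddCommGroup E] [NormedSpace ℂ E]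

theorem BanachBimodule.IsDual.ext {m : BanachBimodule A B E} {P : Submodule ℂ (StrongDual ℂ E)}
    (h : m.IsDual P) {x y : E} (hxy : ∀ φ ∈ P, φ x = φ y) : x = y := by
  rw [← sub_eq_zero, ← norm_eq_zero, ← h.norm_eq, norm_eq_zero]
  ext φ
  simp [hxy φ φ.2]

end Dual

theorem diagAdjoint_apply_eq {A : Type*} [NonUnitalNormedRing A] [NormedSpace ℂ A]
    [IsScalarTower ℂ A A] [SMulCommClass ℂ A A] [DualBanachAlgebra A]
    (M : StrongDual ℂ (SepWStar A)) (φ : DualBanachAlgebra.predual (A := A)) :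
    M (diagAdjoint A φ) = (φ : StrongDual ℂ A) (diagWStar M) := by
  change M.comp (diagAdjoint A) φ = predualEquiv A (diagWStar M) φ
  rw [diagWStar, LinearIsometryEquiv.apply_symm_apply]

/-- The bilinear forms `(a, b) ↦ φ (a · D b)`, for `φ` in the predual of a normal dual bimodule and
a weak-star continuous operator `D`, as a bounded operator of `φ`. -/
def BanachBimodule.sepWStarForm {A E : Type*} [NonUnitalNormedRing A] [NormedSpace ℂ A]
    [IsScalarTower ℂ A A] [SMulCommClass ℂ A A] [DualBanachAlgebra A]
    [NormedAddCommGroup E] [NormedSpace ℂ E] (m : BanachBimodule A A E)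
    {P : Submodule ℂ (StrongDual ℂ E)} (hP : m.IsDual P) (hn : m.IsNormal P) (D : A →L[ℂ] E)
    (hD : Continuous[wstarAlg A, wstar P] D) : P →L[ℂ] SepWStar A :=
  ContinuousLinearMap.codRestrict
    ((((ContinuousLinearMap.compL ℂ A (A →L[ℂ] E) (A →L[ℂ] ℂ)).flip
        (((ContinuousLinearMap.compL ℂ A E E).flip D).comp m.left)).comp
      (ContinuousLinearMap.compL ℂ A E ℂ)).comp (Submodule.subtypeL _))
    (SepWStar A) (by
      intro φ
      refine ⟨fun a => ?_, fun b => ?_⟩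
      · have h := continuous_wstar_apply P (hP.comp_left_mem φ φ.2 a)
        have h' := @Continuous.comp _ _ _ (wstarAlg A) (wstar P) _ _ _ h hD
        exact h'
      · have h := continuous_wstar_apply P φ.2
        have h' := @Continuous.comp _ _ _ (wstarAlg A) (wstar P) _ _ _ h (hn (D b)).1
        exact h')

open L1

theorem connesAmenable_of_isNormalVirtualDiagonal {G : Type u} [Group G]
    {M : StrongDual ℂ (SepWStar (L1 G))} (hM : IsNormalVirtualDiagonal M) :
    ConnesAmenable (L1 G) := by
  intro E _ _ _ m P hP hn D hder hD
  have hΔ : diagWStar M = delta 1 := by rw [← hM.2 (delta 1), delta_one_mul]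
  let S := m.sepWStarForm hP hn D hD
  obtain ⟨x, hx⟩ := hP.surjective (M.comp S)
  have hx' (φ : P) : (φ : StrongDual ℂ E) x = M (S φ) := by
    rw [← toPredualDual_apply, hx]; rfl
  -- Move `a` across `M` in the form `(b, c) ↦ φ (b · D c)`. Expanding `D (c a)` by the derivation
  -- rule leaves `φ (b c · D a)`, which `M` evaluates through its diagonal `delta 1`.
  have key (a : L1 G) : m.left (delta 1) (D a) = m.left a x - m.right a x := by
    refine hP.ext fun φ hφ => ?_
    let φl : P := ⟨_, hP.comp_left_mem φ hφ a⟩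
    let φr : P := ⟨_, hP.comp_right_mem φ hφ a⟩
    let ψ : StrongDual ℂ (L1 G) := φ.comp (m.left.flip (D a))
    have hψ : ψ ∈ c0 G := mem_c0_of_continuous <|
      @Continuous.comp _ _ _ (wstarAlg (L1 G)) (wstar P) _ _ _
        (continuous_wstar_apply P hφ) (hn (D a)).1
    have h1 : φ (m.left a x) = M (S φl) := hx' φl
    have h2 : φ (m.right a x) = M (S φr) := hx' φr
    have h3 : φ (m.left (delta 1) (D a)) = M (diagAdjoint (L1 G) ⟨ψ, hψ⟩) := by
      rw [diagAdjoint_apply_eq, hΔ]; rfl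
    have h4 : S φl = SepWStar.actRight (S ⟨φ, hφ⟩) a := by
      ext b c
      change φ (m.left a (m.left b (D c))) = φ (m.left (a * b) (D c))
      rw [m.left_mul]
    have h5 : SepWStar.actLeft a (S ⟨φ, hφ⟩) = diagAdjoint (L1 G) ⟨ψ, hψ⟩ + S φr := by
      ext b c
      change φ (m.left b (D (c * a))) =
        φ (m.left (b * c) (D a)) + φ (m.right a (m.left b (D c)))
      rw [hder, map_add, map_add, m.left_mul, m.left_right]
    rw [map_sub, h1, h2, h3, h4, hM.1, h5, map_add, add_sub_cancel_right]
  have hz (a : L1 G) : D a = m.left (delta 1) (D a) + m.right a (D (delta 1)) := by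
    conv_lhs => rw [← delta_one_mul a, hder]
  -- Write `e = delta 1`. Applying `e` to `D a = e · D a + D e · a` gives `e · D e · a = 0`.
  have he (a : L1 G) : m.left (delta 1) (m.right a (D (delta 1))) = 0 := by
    have := congrArg (m.left (delta 1)) (hz a)
    rwa [map_add, ← m.left_mul, delta_one_mul, left_eq_add] at this
  -- The correction `e · D e - D e` is killed by every left action, and its right action by `a` is
  -- `-D e · a`. It thus supplies exactly the part of `D a` missing from `key`.
  refine ⟨x + (m.left (delta 1) (D (delta 1)) - D (delta 1)), fun a => ?_⟩
  rw [map_add, map_add, map_sub, map_sub, ← m.left_mul, mul_delta_one, sub_self, ← m.left_right,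
    he, zero_sub, sub_eq_add_neg, neg_add, neg_neg, add_zero, ← add_assoc, ← sub_eq_add_neg,
    ← key, ← hz]

/-! ### Positive parts of functionals and the passage to a mean -/

section PositivePart

open Pointwise

/-- The positive part of an order bounded functional on a vector lattice. -/
theorem exists_positivePart {V : Type*} [Lattice V] [AddCommGroup V] [IsOrderedAddMonoid V]
    [Module ℝ V] [PosSMulMono ℝ V] (r : V →ₗ[ℝ] ℝ)
    (hr : ∀ f, 0 ≤ f → BddAbove (r '' Set.Icc 0 f)) :
    ∃ q : V →ₗ[ℝ] ℝ, ∀ f, 0 ≤ f → q f = sSup (r '' Set.Icc 0 f) := by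
  set p : V → ℝ := fun f => sSup (r '' Set.Icc 0 f) with hp
  have hne (f : V) (hf : 0 ≤ f) : (r '' Set.Icc 0 f).Nonempty :=
    (Set.nonempty_Icc.2 hf).image r
  have hadd (f g : V) (hf : 0 ≤ f) (hg : 0 ≤ g) : p (f + g) = p f + p g := by
    have : Set.Icc 0 (f + g) = Set.Icc 0 f + Set.Icc 0 g := by
      ext h
      rw [Set.mem_add]
      constructor
      · rintro ⟨h0, h1⟩
        -- Riesz decomposition: the largest part of `h` below `f` leaves a remainder below `g`.
        refine ⟨h ⊓ f, ⟨le_inf h0 hf, inf_le_right⟩, h - h ⊓ f, ⟨?_, ?_⟩, by abel⟩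
        · exact sub_nonneg.2 inf_le_left
        · rw [sub_le_comm]
          exact le_inf (sub_le_self _ hg) (sub_le_iff_le_add.2 h1)
      · rintro ⟨a, ha, b, hb, rfl⟩
        exact ⟨add_nonneg ha.1 hb.1, add_le_add ha.2 hb.2⟩
    simp only [hp]
    rw [this, Set.image_add, csSup_add (hne f hf) (hr f hf) (hne g hg) (hr g hg)]
  have hsmul (c : ℝ) (f : V) (hc : 0 < c) : p (c • f) = c * p f := by
    have : Set.Icc 0 (c • f) = c • Set.Icc 0 f := by
      have := (OrderIso.smulRight (β := V) hc).image_Icc 0 f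
      simp only [OrderIso.smulRight_apply, smul_zero] at this
      exact this.symm
    simp only [hp]
    rw [this, Set.image_smul_comm _ _ _ (fun b => map_smul r c b),
      Real.sSup_smul_of_nonneg hc.le, smul_eq_mul]
  -- The difference `p a - p b` depends only on `a - b`, so any decomposition into positive elements
  -- may be used in place of the canonical one.
  have hsub (a b : V) (ha : 0 ≤ a) (hb : 0 ≤ b) : p (a - b)⁺ - p (a - b)⁻ = p a - p b := by
    have h := posPart_sub_negPart (a - b)
    rw [sub_eq_sub_iff_add_eq_add] at h
    have h' := congrArg p h
    rw [hadd _ _ (posPart_nonneg _) hb, hadd _ _ ha (negPart_nonneg _)] at h'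
    linarith
  have hp0 : p 0 = 0 := by
    have := hadd 0 0 le_rfl le_rfl
    rw [add_zero] at this
    linarith
  have hpos (c : ℝ) (hc : 0 < c) (f : V) :
      p (c • f)⁺ - p (c • f)⁻ = c * (p f⁺ - p f⁻) := by
    conv_lhs => rw [← posPart_sub_negPart f, smul_sub]
    rw [hsub _ _ (smul_nonneg hc.le (posPart_nonneg f)) (smul_nonneg hc.le (negPart_nonneg f)),
      hsmul _ _ hc, hsmul _ _ hc, mul_sub]
  refine ⟨{ toFun := fun f => p f⁺ - p f⁻, map_add' := fun f g => ?_, map_smul' := fun c f => ?_ },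
    fun f hf => ?_⟩
  · have h : f + g = (f⁺ + g⁺) - (f⁻ + g⁻) := by
      nth_rw 1 [← posPart_sub_negPart f, ← posPart_sub_negPart g]
      abel
    rw [h, hsub _ _ (add_nonneg (posPart_nonneg _) (posPart_nonneg _))
      (add_nonneg (negPart_nonneg _) (negPart_nonneg _)),
      hadd _ _ (posPart_nonneg _) (posPart_nonneg _),
      hadd _ _ (negPart_nonneg _) (negPart_nonneg _)]
    ring
  · rw [RingHom.id_apply, smul_eq_mul]
    rcases lt_trichotomy c 0 with hc | rfl | hc
    · have h : c • f = (-c) • (-f) := by simp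
      rw [h, hpos _ (neg_pos.2 hc), posPart_neg, negPart_neg]
      ring
    · simp [hp0]
    · exact hpos c hc f
  · change p f⁺ - p f⁻ = p f
    rw [posPart_of_nonneg hf, negPart_of_nonneg hf, hp0, sub_zero]

end PositivePart

section Mean

open BoundedContinuousFunction

/-- Bounded real functions on a discrete space, as elements of `ℓ^∞`. -/
def BoundedContinuousFunction.toLpTop {G : Type*} [TopologicalSpace G] :
    (G →ᵇ ℝ) →ₗ[ℝ] lp (fun _ : G => ℂ) ⊤ where
  toFun f := ⟨fun x => (f x : ℂ), memℓp_infty ⟨‖f‖, by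
    rintro _ ⟨x, rfl⟩
    simpa using f.norm_coe_le_norm x⟩⟩
  map_add' f g := by ext; simp; rfl
  map_smul' c f := by ext; simp

theorem BoundedContinuousFunction.toLpTop_apply {G : Type*} [TopologicalSpace G] (f : G →ᵇ ℝ)
    (x : G) : toLpTop f x = (f x : ℂ) := rfl

theorem BoundedContinuousFunction.norm_toLpTop_le {G : Type*} [TopologicalSpace G] (f : G →ᵇ ℝ) :
    ‖toLpTop f‖ ≤ ‖f‖ :=
  lp.norm_le_of_forall_le (norm_nonneg _) fun x => by
    rw [toLpTop_apply, Complex.norm_real]; exact f.norm_coe_le_norm x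

/-- The real part of an element of `ℓ^∞`. -/
def lpTopRe {G : Type*} [TopologicalSpace G] [DiscreteTopology G] :
    lp (fun _ : G => ℂ) ⊤ →ₗ[ℝ] (G →ᵇ ℝ) where
  toFun f := ofNormedAddCommGroupDiscrete (fun x => (f x).re) ‖f‖ fun x =>
    (Complex.abs_re_le_norm _).trans (lp.norm_apply_le_norm (by simp) f x)
  map_add' f g := by ext; simp
  map_smul' c f := by ext; simp

theorem lpTopRe_apply {G : Type*} [TopologicalSpace G] [DiscreteTopology G]
    (f : lp (fun _ : G => ℂ) ⊤) (x : G) : lpTopRe f x = (f x).re := rfl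

/-- A bounded left invariant functional with value `1` at `1` gives rise to a left invariant
mean. -/
theorem discreteAmenable_of_invariant {G : Type*} [Group G]
    (n : StrongDual ℂ (lp (fun _ : G => ℂ) ⊤)) (hn1 : n 1 = 1)
    (hn : ∀ g f, n (leftTranslate g f) = n f) : DiscreteAmenable G := by
  let _ : TopologicalSpace G := ⊥
  have : DiscreteTopology G := ⟨rfl⟩
  have : PosSMulMono ℝ (G →ᵇ ℝ) :=
    ⟨fun c hc f g hfg x => mul_le_mul_of_nonneg_left (hfg x) hc⟩
  let r : (G →ᵇ ℝ) →ₗ[ℝ] ℝ :=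
    Complex.reLm ∘ₗ (n.toLinearMap.restrictScalars ℝ) ∘ₗ toLpTop
  have hr (f : G →ᵇ ℝ) : r f = (n (toLpTop f)).re := rfl
  have hbdd (f : G →ᵇ ℝ) (hf : 0 ≤ f) : BddAbove (r '' Set.Icc 0 f) := by
    refine ⟨‖n‖ * ‖f‖, ?_⟩
    rintro _ ⟨h, hh, rfl⟩
    have h1 : ‖h‖ ≤ ‖f‖ := norm_le_norm_of_abs_le_abs <| by
      rw [abs_of_nonneg hh.1, abs_of_nonneg hf]; exact hh.2
    calc r h ≤ ‖n (toLpTop h)‖ := Complex.re_le_norm _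
      _ ≤ ‖n‖ * ‖toLpTop h‖ := n.le_opNorm _
      _ ≤ ‖n‖ * ‖f‖ := by gcongr; exact (norm_toLpTop_le h).trans h1
  obtain ⟨q, hq⟩ := exists_positivePart r hbdd
  have hq0 (f : G →ᵇ ℝ) (hf : 0 ≤ f) : 0 ≤ q f := by
    rw [hq f hf]
    exact le_csSup (hbdd f hf) ⟨0, ⟨le_rfl, hf⟩, map_zero r⟩
  have hmono (f g : G →ᵇ ℝ) (hfg : f ≤ g) : q f ≤ q g := by
    have := hq0 (g - f) (sub_nonneg.2 hfg)
    rwa [map_sub, sub_nonneg] at this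
  have h01 : (0 : G →ᵇ ℝ) ≤ 1 := fun x => zero_le_one
  have hq1 : 1 ≤ q 1 := by
    rw [hq 1 h01]
    refine le_csSup (hbdd 1 h01) ⟨1, ⟨h01, le_rfl⟩, ?_⟩
    have : toLpTop (1 : G →ᵇ ℝ) = 1 := by ext x; simp [toLpTop_apply]
    rw [hr, this, hn1, Complex.one_re]
  have hq1' : 0 < q 1 := zero_lt_one.trans_le hq1
  let τ (g : G) (f : G →ᵇ ℝ) : G →ᵇ ℝ := 
    f.compContinuous ⟨fun x => g⁻¹ * x, continuous_of_discreteTopology⟩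
  have hτ (g : G) (f : G →ᵇ ℝ) (x : G) : τ g f x = f (g⁻¹ * x) := rfl
  have hrτ (g : G) (f : G →ᵇ ℝ) : r (τ g f) = r f := by
    rw [hr, hr, ← hn g (toLpTop f)]
    rfl
  have hinv (g : G) (f : G →ᵇ ℝ) : τ g⁻¹ (τ g f) = f := by
    ext x; simp [hτ]
  have hsub (g : G) (f : G →ᵇ ℝ) : r '' Set.Icc 0 f ⊆ r '' Set.Icc 0 (τ g f) := by
    rintro _ ⟨h, hh, rfl⟩
    exact ⟨τ g h, ⟨fun x => hh.1 (g⁻¹ * x), fun x => hh.2 (g⁻¹ * x)⟩, hrτ g h⟩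
  have hqpos (g : G) (f : G →ᵇ ℝ) (hf : 0 ≤ f) : q (τ g f) = q f := by
    rw [hq f hf, hq (τ g f) fun x => hf (g⁻¹ * x)]
    congr 1
    -- The reverse inclusion is the same one for `g⁻¹` and the translate. Equal value sets give
    -- equal suprema.
    refine (hsub g f).antisymm' ?_
    simpa only [hinv] using hsub g⁻¹ (τ g f)
  have hqτ (g : G) (f : G →ᵇ ℝ) : q (τ g f) = q f := by
    have h : τ g f = τ g f⁺ - τ g f⁻ := by
      conv_lhs => rw [← posPart_sub_negPart f]
      rfl
    rw [h, map_sub, hqpos g _ (posPart_nonneg f), hqpos g _ (negPart_nonneg f), ← map_sub,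
      posPart_sub_negPart]
  have hle (f : lp (fun _ : G => ℂ) ⊤) : q (lpTopRe f) ≤ q 1 * ‖f‖ := by
    rw [mul_comm, ← smul_eq_mul, ← map_smul]
    refine hmono _ _ fun x => ?_
    change (f x).re ≤ ‖f‖ * 1
    rw [mul_one]
    exact (Complex.re_le_norm _).trans (lp.norm_apply_le_norm (by simp) f x)
  let μ : StrongDual ℝ (lp (fun _ : G => ℂ) ⊤) :=
    LinearMap.mkContinuous ((q 1)⁻¹ • q ∘ₗ lpTopRe) 1 fun f => by
      change ‖(q 1)⁻¹ * q (lpTopRe f)‖ ≤ 1 * ‖f‖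
      rw [norm_mul, norm_inv, Real.norm_of_nonneg hq1'.le, one_mul, inv_mul_le_iff₀ hq1',
        Real.norm_eq_abs, abs_le', ← map_neg, ← map_neg]
      exact ⟨hle f, by simpa using hle (-f)⟩
  have hμ (f : lp (fun _ : G => ℂ) ⊤) : μ f = (q 1)⁻¹ * q (lpTopRe f) := rfl
  have hμτ (g : G) (f : lp (fun _ : G => ℂ) ⊤) : μ (leftTranslate g f) = μ f := by
    rw [hμ, hμ, ← hqτ g (lpTopRe f)]
    rfl
  have hre : lpTopRe (1 : lp (fun _ : G => ℂ) ⊤) = 1 := by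
    ext x; simp [lpTopRe_apply]
  -- The complex extension is `f ↦ μ f - i μ (i f)`; at `1` its second term vanishes because `i` has
  -- zero real part.
  have him : lpTopRe (Complex.I • (1 : lp (fun _ : G => ℂ) ⊤)) = 0 := by
    ext x; simp [lpTopRe_apply]
  have hm1 : (μ.extendRCLike : StrongDual ℂ (lp (fun _ : G => ℂ) ⊤)) 1 = 1 := by
    rw [StrongDual.extendRCLike_apply, hμ, hμ]
    change _ - Complex.I * ((_ * q (lpTopRe (Complex.I • 1)) : ℝ) : ℂ) = 1
    rw [hre, him, map_zero, inv_mul_cancel₀ hq1'.ne']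
    simp
  refine ⟨μ.extendRCLike, le_antisymm ?_ ?_, hm1, fun g f => ?_⟩
  · rw [StrongDual.norm_extendRCLike]
    exact LinearMap.mkContinuous_norm_le _ zero_le_one _
  · have := (μ.extendRCLike : StrongDual ℂ (lp (fun _ : G => ℂ) ⊤)).le_opNorm 1
    rwa [hm1, norm_one, norm_one, mul_one] at this
  · have h : leftTranslate g ((RCLike.I : ℂ) • f) = (RCLike.I : ℂ) • leftTranslate g f := rfl
    rw [StrongDual.extendRCLike_apply, StrongDual.extendRCLike_apply, ← h, hμτ, hμτ]

end Mean

/-! ### Dual bimodules from operators on a predual -/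

section DualOfPredual

variable {A B X : Type*} [NonUnitalNormedRing A] [NormedSpace ℂ A]
  [NonUnitalNormedRing B] [NormedSpace ℂ B] [NormedAddCommGroup X] [NormedSpace ℂ X]

/-- The canonical predual of a dual space, the image of `X` in its bidual. -/
def canonicalPredual (X : Type*) [NormedAddCommGroup X] [NormedSpace ℂ X] :
    Submodule ℂ (StrongDual ℂ (StrongDual ℂ X)) :=
  (NormedSpace.inclusionInDoubleDual ℂ X).range

theorem forall_mem_canonicalPredual {p : StrongDual ℂ (StrongDual ℂ X) → Prop} :
    (∀ φ ∈ canonicalPredual X, p φ) ↔ ∀ ξ, p (NormedSpace.inclusionInDoubleDual ℂ X ξ) :=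
  ⟨fun h ξ => h _ ⟨ξ, rfl⟩, by rintro h _ ⟨ξ, rfl⟩; exact h ξ⟩

/-- A dual space on which both algebras act by adjoints of operators on the predual is a dual
bimodule. -/
theorem BanachBimodule.isDual_canonicalPredual [CompleteSpace X]
    (m : BanachBimodule A B (StrongDual ℂ X)) (U : A → X →L[ℂ] X) (V : B → X →L[ℂ] X)
    (hU : ∀ a Λ, m.left a Λ = Λ.comp (U a)) (hV : ∀ b Λ, m.right b Λ = Λ.comp (V b)) :
    m.IsDual (canonicalPredual X) where
  isClosed := by
    have := (NormedSpace.inclusionInDoubleDualLi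
      (E := X) ℂ).isometry.isClosedEmbedding.isClosed_range
    exact this
  comp_left_mem := by
    rintro _ ⟨ξ, rfl⟩ a
    exact ⟨U a ξ, by ext Λ; simp [hU]⟩
  comp_right_mem := by
    rintro _ ⟨ξ, rfl⟩ b
    exact ⟨V b ξ, by ext Λ; simp [hV]⟩
  norm_eq Λ := by
    refine le_antisymm ?_ ?_
    · refine ContinuousLinearMap.opNorm_le_bound _ (norm_nonneg _) fun φ => ?_
      rw [mul_comm]
      exact (φ : StrongDual ℂ (StrongDual ℂ X)).le_opNorm Λ
    · refine ContinuousLinearMap.opNorm_le_bound _ (norm_nonneg _) fun ξ => ?_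
      have h := (toPredualDual (canonicalPredual X) Λ).le_opNorm
        ⟨NormedSpace.inclusionInDoubleDual ℂ X ξ, ξ, rfl⟩
      refine h.trans ?_
      gcongr
      exact NormedSpace.double_dual_bound ℂ X ξ
  surjective F := by
    refine ⟨F.comp ((NormedSpace.inclusionInDoubleDual ℂ X).codRestrict (canonicalPredual X)
      fun ξ => ⟨ξ, rfl⟩), ?_⟩
    ext ⟨_, ξ, rfl⟩
    rfl

end DualOfPredual

namespace L1

section Bimodule

variable {G : Type*} {V X : Type*} [NormedAddCommGroup V] [NormedSpace ℂ V]
  [NormedAddCommGroup X] [NormedSpace ℂ X]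

/-- Bounded bilinear maps on `ℓ¹(G)` that agree on the point masses are equal. -/
theorem clm_ext₂ {S T : L1 G →L[ℂ] L1 G →L[ℂ] V}
    (h : ∀ g k, S (delta g) (delta k) = T (delta g) (delta k)) : S = T :=
  clm_ext fun g => clm_ext fun k => h g k

variable [Group G]

/-- Both sides are bounded bilinear in `(a, b)`, so a representation of `G` by bounded operators
with a bounded linear extension `W` extends multiplicatively. -/
theorem map_mul_of_delta {W : L1 G →L[ℂ] X →L[ℂ] X}
    (h : ∀ g k, W (delta (g * k)) = (W (delta g)).comp (W (delta k))) (a b : L1 G) :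
    W (a * b) = (W a).comp (W b) := by
  have : (ContinuousLinearMap.compL ℂ (L1 G) (L1 G) (X →L[ℂ] X) W).comp
      (ContinuousLinearMap.mul ℂ (L1 G)) =
      (ContinuousLinearMap.compL ℂ X X X).bilinearComp W W :=
    clm_ext₂ fun g k => by simpa [delta_mul_delta] using h g k
  exact congrArg (fun S : L1 G →L[ℂ] L1 G →L[ℂ] X →L[ℂ] X => S a b) this

theorem map_mul_of_delta' {W : L1 G →L[ℂ] X →L[ℂ] X}
    (h : ∀ g k, W (delta (g * k)) = (W (delta k)).comp (W (delta g))) (a b : L1 G) :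
    W (a * b) = (W b).comp (W a) := by
  have : (ContinuousLinearMap.compL ℂ (L1 G) (L1 G) (X →L[ℂ] X) W).comp
      (ContinuousLinearMap.mul ℂ (L1 G)) =
      (ContinuousLinearMap.compL ℂ X X X).flip.bilinearComp W W :=
    clm_ext₂ fun g k => by simpa [delta_mul_delta] using h g k
  exact congrArg (fun S : L1 G →L[ℂ] L1 G →L[ℂ] X →L[ℂ] X => S a b) this

theorem commute_of_delta {U V : L1 G →L[ℂ] X →L[ℂ] X}
    (h : ∀ g k, (U (delta g)).comp (V (delta k)) = (V (delta k)).comp (U (delta g)))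
    (a b : L1 G) : (U a).comp (V b) = (V b).comp (U a) := by
  have : (ContinuousLinearMap.compL ℂ X X X).bilinearComp U V =
      (ContinuousLinearMap.compL ℂ X X X).flip.bilinearComp U V :=
    clm_ext₂ fun g k => by simpa using h g k
  exact congrArg (fun S : L1 G →L[ℂ] L1 G →L[ℂ] X →L[ℂ] X => S a b) this

/-- The bimodule structure on a dual space given by the adjoints of commuting actions of `ℓ¹(G)` on
the predual. -/
def dualBimodule (U V : L1 G →L[ℂ] X →L[ℂ] X)
    (hU : ∀ g k, U (delta (g * k)) = (U (delta k)).comp (U (delta g)))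
    (hV : ∀ g k, V (delta (g * k)) = (V (delta g)).comp (V (delta k)))
    (hUV : ∀ g k, (U (delta g)).comp (V (delta k)) = (V (delta k)).comp (U (delta g))) :
    BanachBimodule (L1 G) (L1 G) (StrongDual ℂ X) where
  left := (ContinuousLinearMap.compL ℂ X X ℂ).flip.comp U
  right := (ContinuousLinearMap.compL ℂ X X ℂ).flip.comp V
  left_mul a b Λ := by
    change Λ.comp (U (a * b)) = (Λ.comp (U b)).comp (U a)
    rw [map_mul_of_delta' hU, ContinuousLinearMap.comp_assoc]
  right_mul a b Λ := by
    change Λ.comp (V (a * b)) = (Λ.comp (V a)).comp (V b)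
    rw [map_mul_of_delta hV, ContinuousLinearMap.comp_assoc]
  left_right a b Λ := by
    change (Λ.comp (V b)).comp (U a) = (Λ.comp (U a)).comp (V b)
    rw [ContinuousLinearMap.comp_assoc, ContinuousLinearMap.comp_assoc, commute_of_delta hUV]

end Bimodule

end L1

/-! ### Vector-valued `ℓ²` and coefficients vanishing at infinity -/

section LpTwo

variable {G Y : Type*} [NormedAddCommGroup Y] [NormedSpace ℂ Y]

/-- The coefficients of a bounded functional on `ℓ²(G, Y)` along a bounded family vanish at
infinity. -/
theorem tendsto_apply_single [DecidableEq G] (Λ : StrongDual ℂ (lp (fun _ : G => Y) 2)) {y : G → Y}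
    {C : ℝ} (hC : 0 ≤ C) (hy : ∀ x, ‖y x‖ ≤ C) :
    Tendsto (fun x => Λ (lp.single 2 x (y x))) cofinite (𝓝 0) := by
  -- Multiplying scalars by `y x` maps scalar `ℓ²` boundedly into `ℓ²(G, Y)`. The pullback of `Λ` is
  -- represented by a vector of a Hilbert space, whose coordinates tend to zero.
  let φ : StrongDual ℂ (lp (fun _ : G => ℂ) 2) :=
    Λ.comp (lp.mapCLM 2 (fun x => ContinuousLinearMap.toSpanSingleton ℂ (y x)) hC
      (by simpa using hy))
  let v := (InnerProductSpace.toDual ℂ _).symm φ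
  have hv (x : G) : Λ (lp.single 2 x (y x)) = inner ℂ (v x) 1 := by
    rw [← lp.inner_single_right, InnerProductSpace.toDual_symm_apply]
    change _ = Λ _
    congr 1
    ext z : 2
    by_cases hz : z = x
    · subst hz; simp
    · simp [hz]
  rw [tendsto_zero_iff_norm_tendsto_zero]
  have h := ((lp.memℓp v).summable (by simp)).tendsto_cofinite_zero
  have h2 := (Real.continuous_sqrt.tendsto 0).comp h
  simpa [hv, Function.comp_def] using h2

/-- Finitely supported vectors are dense, and the uniform bound on the operators controls the tail.
-/
theorem tendsto_apply_of_single [DecidableEq G] {ι : Type*} {l : Filter ι}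
    (Λ : StrongDual ℂ (lp (fun _ : G => Y) 2))
    (W : ι → lp (fun _ : G => Y) 2 →L[ℂ] lp (fun _ : G => Y) 2) {C : ℝ} (hW : ∀ i, ‖W i‖ ≤ C)
    (h : ∀ x y, Tendsto (fun i => Λ (W i (lp.single 2 x y))) l (𝓝 0))
    (ξ : lp (fun _ : G => Y) 2) : Tendsto (fun i => Λ (W i ξ)) l (𝓝 0) := by
  rw [Metric.tendsto_nhds]
  intro ε hε
  -- That `C` is nonnegative is read off from some index, which exists once the trivial filter is
  -- excluded.
  rcases l.eq_or_neBot with rfl | hl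
  · simp
  have hC : 0 ≤ C := (norm_nonneg _).trans (hW (Classical.choice hl.nonempty))
  have hs := lp.hasSum_single (p := 2) (by simp) ξ
  obtain ⟨s, hs⟩ := ((Metric.tendsto_nhds.1 hs) (ε / 2 / (‖Λ‖ * C + 1)) (by positivity)).exists
  have hfin : Tendsto (fun i => Λ (W i (∑ x ∈ s, lp.single 2 x (ξ x)))) l (𝓝 0) := by
    simp only [map_sum]
    simpa using tendsto_finsetSum s fun x _ => h x (ξ x)
  filter_upwards [(Metric.tendsto_nhds.1 hfin) (ε / 2) (half_pos hε)] with i hi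
  rw [dist_zero_right] at hi ⊢
  rw [dist_comm, dist_eq_norm, lt_div_iff₀ (by positivity)] at hs
  set η := ∑ x ∈ s, lp.single 2 x (ξ x)
  have h1 : ‖Λ (W i (ξ - η))‖ ≤ ‖Λ‖ * (C * ‖ξ - η‖) :=
    (Λ.le_opNorm _).trans (by gcongr; exact (W i).le_of_opNorm_le (hW i) _)
  have h2 : Λ (W i ξ) = Λ (W i (ξ - η)) + Λ (W i η) := by simp
  rw [h2]
  have h3 := norm_add_le (Λ (W i (ξ - η))) (Λ (W i η))
  nlinarith [norm_nonneg (ξ - η)]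

/-- Precomposition with a permutation of the index set, on `ℓ²`. -/
def lpTwoReindex (e : G ≃ G) : lp (fun _ : G => Y) 2 →L[ℂ] lp (fun _ : G => Y) 2 :=
  LinearMap.mkContinuous
    { toFun := fun ξ => ⟨fun x => ξ (e x), memℓp_gen
        (e.summable_iff.2 ((lp.memℓp ξ).summable (by simp)))⟩
      map_add' := fun _ _ => by ext; simp; rfl
      map_smul' := fun _ _ => by ext; simp } 1
    fun ξ => by
      rw [one_mul]
      refine lp.norm_le_of_tsum_le (by simp) (norm_nonneg _) ?_
      rw [lp.norm_rpow_eq_tsum (by simp)]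
      exact (e.tsum_eq fun x => ‖ξ x‖ ^ (2 : ENNReal).toReal).le

theorem lpTwoReindex_apply (e : G ≃ G) (ξ : lp (fun _ : G => Y) 2) (x : G) :
    lpTwoReindex e ξ x = ξ (e x) := rfl

theorem norm_lpTwoReindex_le (e : G ≃ G) :
    ‖(lpTwoReindex e : lp (fun _ : G => Y) 2 →L[ℂ] lp (fun _ : G => Y) 2)‖ ≤ 1 :=
  LinearMap.mkContinuous_norm_le _ zero_le_one _

theorem lpTwoReindex_single [DecidableEq G] (e : G ≃ G) (x : G) (y : Y) :
    lpTwoReindex e (lp.single 2 x y) = lp.single 2 (e.symm x) y := by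
  ext z : 2
  rw [lpTwoReindex_apply]
  by_cases hz : e z = x
  · obtain rfl := hz
    rw [e.symm_apply_apply, lp.single_apply_self, lp.single_apply_self]
  · rw [lp.single_apply_ne _ _ _ hz, lp.single_apply_ne]
    rintro rfl
    simp at hz

end LpTwo

/-! ### Cocycles as derivations into the dual of `ℓ²(G, Y)` -/

section Cocycle

open L1

variable {G : Type*} [Group G] {Y : Type*} [NormedAddCommGroup Y] [NormedSpace ℂ Y]

/-- The operator `(U_g ξ) (x) = ξ (g x)`. -/
def leftOp (Y : Type*) [NormedAddCommGroup Y] [NormedSpace ℂ Y] (g : G) :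
    lp (fun _ : G => Y) 2 →L[ℂ] lp (fun _ : G => Y) 2 := lpTwoReindex (Equiv.mulLeft g)

/-- The operator `(V_g ξ) (x) = T_g (ξ (x g))` of a bounded family `T`. -/
def rightOp {T : G → Y →L[ℂ] Y} {C : ℝ} (hC : 0 ≤ C) (hT : ∀ g, ‖T g‖ ≤ C) (g : G) :
    lp (fun _ : G => Y) 2 →L[ℂ] lp (fun _ : G => Y) 2 :=
  (lp.mapCLM 2 (fun _ => T g) hC fun _ => hT g).comp (lpTwoReindex (Equiv.mulRight g))

variable {T : G → Y →L[ℂ] Y} {C : ℝ} (hC : 0 ≤ C) (hT : ∀ g, ‖T g‖ ≤ C)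

theorem leftOp_apply (g : G) (ξ : lp (fun _ : G => Y) 2) (x : G) :
    leftOp Y g ξ x = ξ (g * x) := rfl

theorem rightOp_apply (g : G) (ξ : lp (fun _ : G => Y) 2) (x : G) :
    rightOp hC hT g ξ x = T g (ξ (x * g)) := rfl

theorem norm_leftOp_le (g : G) : ‖leftOp Y g‖ ≤ 1 := norm_lpTwoReindex_le _

theorem norm_rightOp_le (g : G) : ‖rightOp hC hT g‖ ≤ C := by
  refine (ContinuousLinearMap.opNorm_comp_le _ _).trans ?_
  exact (mul_le_mul (lp.norm_mapCLM_le _ _ _ _) (norm_lpTwoReindex_le _) (norm_nonneg _)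
    hC).trans_eq (mul_one C)

theorem leftOp_mul (g h : G) : leftOp Y (g * h) = (leftOp Y h).comp (leftOp Y g) := by
  ext ξ x
  simp [leftOp_apply, mul_assoc]

theorem rightOp_mul (hmul : ∀ g h, T (g * h) = (T g).comp (T h)) (g h : G) :
    rightOp hC hT (g * h) = (rightOp hC hT g).comp (rightOp hC hT h) := by
  ext ξ x
  simp [rightOp_apply, mul_assoc, hmul]

theorem leftOp_comp_rightOp (g h : G) :
    (leftOp Y g).comp (rightOp hC hT h) = (rightOp hC hT h).comp (leftOp Y g) := by
  ext ξ x
  simp [rightOp_apply, leftOp_apply, mul_assoc]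

theorem leftOp_single [DecidableEq G] (g x : G) (y : Y) :
    leftOp Y g (lp.single 2 x y) = lp.single 2 (g⁻¹ * x) y :=
  lpTwoReindex_single _ _ _

theorem rightOp_single [DecidableEq G] (g x : G) (y : Y) :
    rightOp hC hT g (lp.single 2 x y) = lp.single 2 (x * g⁻¹) (T g y) := by
  rw [rightOp, ContinuousLinearMap.comp_apply, lpTwoReindex_single]
  ext z : 2
  change T g (lp.single (E := fun _ : G => Y) 2 (x * g⁻¹) y z) = _
  by_cases hz : z = x * g⁻¹
  · subst hz; simp
  · simp [hz]

theorem tendsto_leftOp (Λ : StrongDual ℂ (lp (fun _ : G => Y) 2)) (ξ : lp (fun _ : G => Y) 2) :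
    Tendsto (fun g => Λ (leftOp Y g ξ)) cofinite (𝓝 0) := by
  classical
  refine tendsto_apply_of_single Λ (leftOp Y) norm_leftOp_le (fun x y => ?_) ξ
  simp only [leftOp_single]
  have h := tendsto_apply_single Λ (y := fun _ => y) (norm_nonneg y) fun _ => le_rfl
  have hinj : Function.Injective fun g : G => g⁻¹ * x :=
    (mul_left_injective x).comp inv_injective
  exact h.comp hinj.tendsto_cofinite

theorem tendsto_rightOp (Λ : StrongDual ℂ (lp (fun _ : G => Y) 2)) (ξ : lp (fun _ : G => Y) 2) :
    Tendsto (fun g => Λ (rightOp hC hT g ξ)) cofinite (𝓝 0) := by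
  classical
  refine tendsto_apply_of_single Λ (rightOp hC hT) (norm_rightOp_le hC hT) (fun x y => ?_) ξ
  simp only [rightOp_single]
  -- The image vector is `T g y` at the site `z = x g⁻¹`, so `g = z⁻¹ x`: the vector varies with its
  -- site, but stays bounded.
  have h := tendsto_apply_single Λ (y := fun z => T (z⁻¹ * x) y)
    (mul_nonneg hC (norm_nonneg y)) fun z => (T (z⁻¹ * x)).le_of_opNorm_le (hT _) y
  have hinj : Function.Injective fun g : G => x * g⁻¹ :=
    (mul_right_injective x).comp inv_injective
  refine (h.comp hinj.tendsto_cofinite).congr fun g => ?_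
  simp

/-- If `ℓ¹(G)` is Connes-amenable, then bounded cocycles with values in the dual of a Banach space
on which `G` acts by uniformly bounded operators are trivial. -/
theorem exists_eq_sub_of_connesAmenable {G : Type u} [Group G] (h : ConnesAmenable (L1 G))
    {Y : Type u} [NormedAddCommGroup Y] [NormedSpace ℂ Y] [CompleteSpace Y]
    {T : G → Y →L[ℂ] Y} {C : ℝ} (hC : 0 ≤ C) (hT : ∀ g, ‖T g‖ ≤ C)
    (hmul : ∀ g k, T (g * k) = (T g).comp (T k))
    {κ : G → StrongDual ℂ Y} (hκ : ∀ g, ‖κ g‖ ≤ C)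
    (hcoc : ∀ g k, κ (g * k) = κ k + (κ g).comp (T k)) :
    ∃ s : StrongDual ℂ Y, ∀ g, κ g = s - s.comp (T g) := by
  classical
  let X := lp (fun _ : G => Y) 2
  let U : L1 G →L[ℂ] X →L[ℂ] X := lift (leftOp Y) zero_le_one norm_leftOp_le
  let V : L1 G →L[ℂ] X →L[ℂ] X := lift (rightOp hC hT) hC (norm_rightOp_le hC hT)
  have hU (g : G) : U (delta g) = leftOp Y g := lift_delta _ _ _ _
  have hV (g : G) : V (delta g) = rightOp hC hT g := lift_delta _ _ _ _
  let m := dualBimodule U V (fun g k => by rw [hU, hU, hU, leftOp_mul])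
    (fun g k => by rw [hV, hV, hV, rightOp_mul hC hT hmul])
    (fun g k => by rw [hU, hV, leftOp_comp_rightOp])
  have hl (a : L1 G) (Λ : StrongDual ℂ X) : m.left a Λ = Λ.comp (U a) := rfl
  have hr (a : L1 G) (Λ : StrongDual ℂ X) : m.right a Λ = Λ.comp (V a) := rfl
  have hn : m.IsNormal (canonicalPredual X) := fun Λ => by
    refine ⟨(continuous_wstarAlg_wstar_iff (T := m.left.flip Λ)).2
      (forall_mem_canonicalPredual.2 fun ξ => ?_),
      (continuous_wstarAlg_wstar_iff (T := m.right.flip Λ)).2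
      (forall_mem_canonicalPredual.2 fun ξ => ?_)⟩
    · refine (tendsto_leftOp Λ ξ).congr fun g => ?_
      rw [NormedSpace.dual_def, ContinuousLinearMap.flip_apply, hl, hU]
      rfl
    · refine (tendsto_rightOp hC hT Λ ξ).congr fun g => ?_
      rw [NormedSpace.dual_def, ContinuousLinearMap.flip_apply, hr, hV]
      rfl
  let d (g : G) : StrongDual ℂ X := (κ g).comp (lp.evalCLM ℂ (fun _ : G => Y) 2 g)
  have hd (g : G) (ξ : X) : d g ξ = κ g (ξ g) := rfl
  have hdle (g : G) (ξ : X) : ‖d g ξ‖ ≤ C * ‖ξ g‖ := (κ g).le_of_opNorm_le (hκ g) _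
  have hdn (g : G) : ‖d g‖ ≤ C := ContinuousLinearMap.opNorm_le_bound _ hC fun ξ =>
    (hdle g ξ).trans (mul_le_mul_of_nonneg_left (lp.norm_apply_le_norm (by simp) ξ g) hC)
  have hdt (ξ : X) : Tendsto (fun g => d g ξ) cofinite (𝓝 0) := by
    refine squeeze_zero_norm (fun g => hdle g ξ) ?_
    have h := ((lp.memℓp ξ).summable (by simp)).tendsto_cofinite_zero
    have h2 := ((Real.continuous_sqrt.tendsto 0).comp h).const_mul C
    simpa [Function.comp_def] using h2
  let D : L1 G →L[ℂ] StrongDual ℂ X := lift d hC hdn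
  have hDd (g : G) : D (delta g) = d g := lift_delta _ _ _ _
  have hder : m.IsDerivation D := fun a b => by
    have : (ContinuousLinearMap.compL ℂ (L1 G) (L1 G) _ D).comp
        (ContinuousLinearMap.mul ℂ (L1 G)) =
        m.left.bilinearComp (ContinuousLinearMap.id ℂ _) D +
          m.right.flip.bilinearComp D (ContinuousLinearMap.id ℂ _) := by
      refine clm_ext₂ fun g k => ?_
      change D (delta g * delta k) =
        (D (delta k)).comp (U (delta g)) + (D (delta g)).comp (V (delta k))
      rw [delta_mul_delta, hDd, hDd, hDd, hU, hV]
      ext ξ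
      -- All three terms see only the coordinate of `ξ` at `g k`, where the derivation rule is the
      -- cocycle identity.
      change κ (g * k) (ξ (g * k)) = κ k (ξ (g * k)) + κ g (T k (ξ (g * k)))
      rw [hcoc]
      rfl
    exact congrArg (fun S : L1 G →L[ℂ] L1 G →L[ℂ] StrongDual ℂ X => S a b) this
  have hD : Continuous[wstarAlg (L1 G), wstar (canonicalPredual X)] D :=
    continuous_wstarAlg_wstar_iff.2 (forall_mem_canonicalPredual.2 fun ξ =>
      (hdt ξ).congr fun g => by rw [NormedSpace.dual_def, hDd])
  obtain ⟨σ, hσ⟩ := h _ m _ (m.isDual_canonicalPredual U V hl hr) hn D hder hD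
  refine ⟨σ.comp (lp.singleContinuousLinearMap ℂ (fun _ : G => Y) 2 1), fun g => ?_⟩
  ext y
  have h1 := hσ (delta g)
  rw [hDd, hl, hr, hU, hV] at h1
  -- Test on a vector supported at `g`: both actions of `g` carry it to the identity, one leaving
  -- `y` unchanged and the other replacing it by `T g y`.
  have h2 := congrArg (fun Λ : StrongDual ℂ X => Λ (lp.single 2 g y)) h1
  change κ g (lp.single (E := fun _ : G => Y) 2 g y g) =
    σ (leftOp Y g (lp.single 2 g y)) - σ (rightOp hC hT g (lp.single 2 g y)) at h2
  rw [lp.single_apply_self, leftOp_single, rightOp_single, inv_mul_cancel, mul_inv_cancel] at h2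
  exact h2

end Cocycle

/-! ### The cocycle that produces an invariant mean -/

section Amenability

open L1

variable {G : Type*} [Group G]

/-- The left translation of bounded functions, corrected by constants so as to take values in the
functions vanishing at the identity: `f ↦ (x ↦ f (g⁻¹ x) - f (g⁻¹))`. -/
def basedTranslate (g : G) : lp (fun _ : G => ℂ) ⊤ →L[ℂ] lp (fun _ : G => ℂ) ⊤ :=
  LinearMap.mkContinuous
    { toFun := fun f => leftTranslate g f - f g⁻¹ • 1
      map_add' := fun f k => by
        ext x
        change (f (g⁻¹ * x) + k (g⁻¹ * x)) - (f g⁻¹ + k g⁻¹) * 1 =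
          (f (g⁻¹ * x) - f g⁻¹ * 1) + (k (g⁻¹ * x) - k g⁻¹ * 1)
        ring
      map_smul' := fun c f => by
        ext x
        change c * f (g⁻¹ * x) - (c * f g⁻¹) * 1 = c * (f (g⁻¹ * x) - f g⁻¹ * 1)
        ring } 2
    fun f => by
      refine lp.norm_le_of_forall_le (by positivity) fun x => ?_
      change ‖f (g⁻¹ * x) - f g⁻¹ * 1‖ ≤ _
      have h1 := lp.norm_apply_le_norm (by simp) f (g⁻¹ * x)
      have h2 := lp.norm_apply_le_norm (by simp) f g⁻¹
      rw [mul_one, two_mul]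
      exact (norm_sub_le _ _).trans (add_le_add h1 h2)

theorem basedTranslate_eq (g : G) (f : lp (fun _ : G => ℂ) ⊤) :
    basedTranslate g f = leftTranslate g f - f g⁻¹ • 1 := rfl

theorem basedTranslate_apply (g : G) (f : lp (fun _ : G => ℂ) ⊤) (x : G) :
    basedTranslate g f x = f (g⁻¹ * x) - f g⁻¹ := by
  change f (g⁻¹ * x) - f g⁻¹ * 1 = _
  rw [mul_one]

theorem norm_basedTranslate_le (g : G) : ‖basedTranslate g‖ ≤ 2 :=
  LinearMap.mkContinuous_norm_le _ zero_le_two _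

/-- Functions vanishing at the identity model the bounded functions modulo constants, so this is
translation on that quotient. The operator at the identity is the projection `f ↦ f - f 1`, not the
identity map. -/
theorem basedTranslate_mul (g h : G) :
    basedTranslate (g * h) = (basedTranslate g).comp (basedTranslate h) := by
  ext f x
  simp [basedTranslate_apply, mul_assoc]

theorem discreteAmenable_of_connesAmenable {G : Type u} [Group G]
    (h : ConnesAmenable (L1 G)) : DiscreteAmenable G := by
  let ev (g : G) : StrongDual ℂ (lp (fun _ : G => ℂ) ⊤) := lp.evalCLM ℂ (fun _ : G => ℂ) ⊤ g
  have hev (g : G) (f : lp (fun _ : G => ℂ) ⊤) : ev g f = f g := rfl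
  have hκ (g : G) : ‖ev 1 - ev g⁻¹‖ ≤ 2 := by
    refine ContinuousLinearMap.opNorm_le_bound _ zero_le_two fun f => ?_
    rw [two_mul]
    exact (norm_sub_le _ _).trans (add_le_add (lp.norm_apply_le_norm (by simp) f _)
      (lp.norm_apply_le_norm (by simp) f _))
  obtain ⟨s, hs⟩ := exists_eq_sub_of_connesAmenable h zero_le_two norm_basedTranslate_le
    basedTranslate_mul hκ fun g k => by
      ext f
      change f 1 - f (g * k)⁻¹ =
        (f 1 - f k⁻¹) + (basedTranslate k f 1 - basedTranslate k f g⁻¹)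
      simp [basedTranslate_apply]
  have hs' (g : G) (f : lp (fun _ : G => ℂ) ⊤) :
      f 1 - f g⁻¹ = s f - (s (leftTranslate g f) - f g⁻¹ * s 1) := by
    have h1 := congrArg (fun Λ : StrongDual ℂ (lp (fun _ : G => ℂ) ⊤) => Λ f) (hs g)
    rw [← smul_eq_mul (f g⁻¹), ← map_smul, ← map_sub s, ← basedTranslate_eq]
    exact h1
  have hs1 : s 1 = 0 := by
    -- With `g = 1` and `f = 1` everything cancels except `s 1`. Hence the constants subtracted by
    -- `basedTranslate` do not affect `s`, and `ev 1 - s` is invariant.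
    have h1 := hs' 1 1
    have h2 : leftTranslate 1 (1 : lp (fun _ : G => ℂ) ⊤) = 1 := rfl
    rw [h2] at h1
    simpa using h1.symm
  refine discreteAmenable_of_invariant (ev 1 - s) ?_ fun g f => ?_
  · change (1 : lp (fun _ : G => ℂ) ⊤) 1 - s 1 = 1
    rw [hs1]; simp
  · change f (g⁻¹ * 1) - s (leftTranslate g f) = f 1 - s f
    have h1 := hs' g f
    rw [hs1] at h1
    rw [mul_one]
    linear_combination -h1

end Amenability

end

theorem corollary5p4 (G : Type*) [Group G] :
    List.TFAE [DiscreteAmenable G, ConnesAmenable (L1 G),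
      ∃ M : StrongDual ℂ (SepWStar (L1 G)), IsNormalVirtualDiagonal M] := by
  tfae_have 1 → 3 := exists_isNormalVirtualDiagonal_of_discreteAmenable
  tfae_have 3 → 2 := fun ⟨_, hM⟩ => connesAmenable_of_isNormalVirtualDiagonal hM
  tfae_have 2 → 1 := discreteAmenable_of_connesAmenable
  tfae_finish
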